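/- Let $p$ be a prime and let $K$ be a field of characteristic $p$ that is complete with respect to a discrete valuation $\nu:K\to\mathbb Z\cup\{\infty\}$. Let $\pi\in K$ with $\nu(\pi)=1$ and let $R=\{x\in K:\nu(x)\ge 0\}$ be the valuation ring. Let $C_p^3=\langle g_1,g_2,g_3\rangle$ be the elementary abelian group of order $p^3$, with generators satisfying $g_i^p=1$. For $x\in K$ put $\wp(x)=x^p-x$. For $x\in K[C_p^3]$ and $y\in K$, define the truncated exponential $$x^{[y]}=\sum_{m=0}^{p-1}\binom{y}{m}(x-1)^m,\qquad \binom{y}{m}=\frac{y(y-1)\cdots(y-m+1)}{m!}.$$ An *$R$-Hopf order* in a finite-dimensional $K$-Hopf algebra $B$ is an $R$-subalgebra $H\subseteq B$ that is finitely generated and projective as an $R$-module and carries an $R$-Hopf algebra structure, extending its $R$-algebra structure, such that the map $K\otimes_R H\to B$ induced by the inclusion is an isomorphism of $K$-Hopf algebras. **Proposition.** Let $i_1,i_2,i_3\ge 0$ be integers and let $\mu,\alpha,\beta\in K$ satisfy $$\nu(\wp(\mu))\ge i_2-pi_1,\quad \nu(\wp(\alpha)+\wp(\mu)\beta)\ge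 i_3-pi_1,\quad \nu(\wp(\beta))\ge i_3-pi_2,\quad \nu(\mu)\ge i_3-i_1,\quad i_2\ge i_3.$$ Then the $R$-subalgebra $$E(i_1,i_2,i_3,\alpha,\beta,\mu)=R\left[\frac{g_1-1}{\pi^{i_1}},\ \frac{g_2g_1^{[\mu]}-1}{\pi^{i_2}},\ \frac{g_3\,g_1^{[\alpha]}\,(g_2g_1^{[\mu]})^{[\beta]}-1}{\pi^{i_3}}\right]\subseteq K[C_p^3]$$ is an $R$-Hopf order in $K[C_p^3]$. -/

import Mathlib

open scoped TensorProduct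

noncomputable section

namespace HopfOrders

/-! ### Discretely valued fields -/

/-- The valuation ring `{x | 0 ≤ ν x}` of an additive valuation on a field. -/
def valRing {K : Type*} [Field K] (ν : AddValuation K (WithTop ℤ)) : Subring K where
  carrier := {x | 0 ≤ ν x}
  mul_mem' {a b} ha hb := by
    simp only [Set.mem_ofPred_eq] at ha hb ⊢
    rw [ν.map_mul]
    exact add_nonneg ha hb
  one_mem' := by simp [ν.map_one]
  add_mem' {a b} ha hb := ν.map_le_add ha hb
  zero_mem' := by simp [ν.map_zero]
  neg_mem' {a} ha := by
    simp only [Set.mem_ofPred_eq] at ha ⊢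
    rwa [ν.map_neg]

/-- Completeness with respect to `ν`: every Cauchy sequence converges. -/
def IsCompleteVal {K : Type*} [Field K] (ν : AddValuation K (WithTop ℤ)) : Prop :=
  ∀ u : ℕ → K,
    (∀ N : ℤ, ∃ n₀ : ℕ, ∀ m ≥ n₀, ∀ n ≥ n₀, (N : WithTop ℤ) ≤ ν (u m - u n)) →
    ∃ l : K, ∀ N : ℤ, ∃ n₀ : ℕ, ∀ n ≥ n₀, (N : WithTop ℤ) ≤ ν (u n - l)

/-! ### Hopf orders -/

/-- The map `ι` from an `R`-Hopf algebra `H` to a `K`-Hopf algebra `B` extends to an isomorphism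
`K ⊗[R] H ≅ B` of `K`-Hopf algebras (an isomorphism of bialgebras between Hopf algebras commutes
with the antipodes). -/
def IsGenericIso (R K : Type*) [CommRing R] [Field K] [Algebra R K]
    {H B : Type*} [Ring H] [HopfAlgebra R H] [Ring B] [HopfAlgebra K B] (ι : H → B) : Prop :=
  ∃ e : (K ⊗[R] H) ≃ₐc[K] B, ∀ h : H, e ((1 : K) ⊗ₜ[R] h) = ι h

/-- An `R`-subalgebra `H` of a `K`-Hopf algebra `B` is an `R`-Hopf order in `B` if it is finitely
generated and projective as an `R`-module, and carries an `R`-Hopf algebra structure (extending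
its `R`-algebra structure) for which the inclusion `H ⊆ B` induces an isomorphism
`K ⊗[R] H ≅ B` of `K`-Hopf algebras. -/
def IsHopfOrder (R K : Type*) [CommRing R] [Field K] [Algebra R K]
    {B : Type*} [Ring B] [HopfAlgebra K B] [Algebra R B] [IsScalarTower R K B]
    (H : Subalgebra R B) : Prop :=
  Module.Finite R H ∧ Module.Projective R H ∧
    ∃ hopf : HopfAlgebra R H,
      hopf.toBialgebra.toAlgebra = H.algebra ∧
      @IsGenericIso R K _ _ _ H B _ hopf _ _ (Subtype.val : H → B)

/-! ### Truncated exponentials -/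

/-- `℘(x) = x ^ p - x`. -/
def wp {K : Type*} [Field K] (p : ℕ) (x : K) : K := x ^ p - x

/-- The generalized binomial coefficient `y (y - 1) ⋯ (y - m + 1) / m!`. It is used only
for `m < p`, where `m!` is invertible in characteristic `p`. -/
def genBinom {K : Type*} [Field K] (y : K) (m : ℕ) : K :=
  (∏ j ∈ Finset.range m, (y - (j : K))) / (m.factorial : K)

/-- The truncated exponential `x^{[y]} = ∑_{m=0}^{p-1} (y choose m) (x - 1)^m`. -/
def truncExp {K : Type*} [Field K] {B : Type*} [CommRing B] [Algebra K B]
    (p : ℕ) (x : B) (y : K) : B :=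
  ∑ m ∈ Finset.range p, genBinom y m • (x - 1) ^ m

/-- The truncated exponential algebra `E(i₁, i₂, i₃, α, β, μ)`: the `R`-subalgebra of the
commutative `K`-algebra `B` generated by `(g₁ - 1) / π^{i₁}`, `(g₂ g₁^{[μ]} - 1) / π^{i₂}` and
`(g₃ g₁^{[α]} (g₂ g₁^{[μ]})^{[β]} - 1) / π^{i₃}`. -/
def truncExpAlgebra {K : Type*} [Field K] (R : Subring K) {B : Type*} [CommRing B] [Algebra K B]
    [Algebra R B] (p : ℕ) (π : K) (g₁ g₂ g₃ : B) (i₁ i₂ i₃ : ℕ) (α β μ : K) : Subalgebra R B :=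
  Algebra.adjoin R
    {(π ^ i₁)⁻¹ • (g₁ - 1),
     (π ^ i₂)⁻¹ • (g₂ * truncExp p g₁ μ - 1),
     (π ^ i₃)⁻¹ • (g₃ * truncExp p g₁ α * truncExp p (g₂ * truncExp p g₁ μ) β - 1)}

end HopfOrders

end

/-! Write `u₂ = g₂ g₁^{[μ]}` and `u₃ = g₃ g₁^{[α]} u₂^{[β]}`. Truncated exponentiation is not
multiplicative in the base, and the proof measures its failure. If `(x - 1)^p = (y - 1)^p = 0` in
characteristic `p`, then with an indeterminate exponent `X` one has `(xy)^{[X]} = x^{[X]} y^{[X]} (1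
+ r (X^p - X))`, where `r² = 0` and `r ∈ (x - 1, y - 1)^p` (`exists_ringTruncExp_mul`). Indeed the
quotient of the two sides, minus `1`, has its `X^m` coefficient in the `m`-th power of the ideal, so
its degree is below `2p`; it is invariant under `X ↦ X + 1` and vanishes at `0`. Only multiples of
`X^p - X` have these properties.

If `x` and `y` are `1` modulo `π^i`, then `r` is divisible by `π^{pi}`. Applied to `g₁ ⊗ 1` and `1 ⊗
g₁`, and then to `u₂`, this gives `Δ(u₂) = (u₂ ⊗ u₂) F` with `F = 1 + ℘(μ) Q`, and `Δ(u₃)` equals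
`u₃ ⊗ u₃` times factors with coefficients `℘(α) + ℘(μ)β` on `Q` and `℘(β)` on multiples of `π^{p
i₂}`. The valuation bounds make these corrections `1` modulo `π^{i₂}` and `π^{i₃}`
(`congrOne_comul`), so the order is closed under `Δ`.

The antipode inverts each generator `u`, and `u⁻¹ = u^{p-1}`; the counit sends each to `1`. Finally
`((u - 1)/π^i)^p = 0`, so `p³` monomials span, and a dimension count makes them a basis
(`exists_basis_truncExpAlgebra`). -/

noncomputable section

namespace HopfOrders

open Module

/-! ### Hopf orders from a common basis and closure under the Hopf operations -/

section Criterion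

variable {R K B : Type*} [CommRing R] [Field K] [Algebra R K] [CommRing B] [HopfAlgebra K B]
  [Algebra R B] [IsScalarTower R K B]

/-- An `R`-linear map sending an `R`-basis to a `K`-basis is injective. -/
theorem injective_of_basis (hRK : Function.Injective (algebraMap R K)) {ι M N : Type*}
    [AddCommGroup M] [Module R M] [AddCommGroup N] [Module K N] [Module R N] [IsScalarTower R K N]
    (bM : Basis ι R M) (bN : Basis ι K N) (f : M →ₗ[R] N) (hf : ∀ i, f (bM i) = bN i) :
    Function.Injective f := by
  have hli : LinearIndependent R bN :=
    bN.linearIndependent.restrict_scalars (fun a b hab => hRK (by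
      simpa [Algebra.algebraMap_eq_smul_one] using hab))
  have : f = (Finsupp.linearCombination R bN).comp bM.repr.toLinearMap :=
    bM.ext fun i => by simp [hf]
  rw [this]
  exact (show Function.Injective (Finsupp.linearCombination R bN) from hli).comp bM.repr.injective

/-- The map `H ⊗[R] H → B ⊗[K] B`. -/
def tensorVal (K : Type*) [Field K] [Algebra R K] [HopfAlgebra K B] [IsScalarTower R K B]
    (H : Subalgebra R B) : H ⊗[R] H →ₐ[R] B ⊗[K] B :=
  Algebra.TensorProduct.lift
    (((Algebra.TensorProduct.includeLeft : B →ₐ[K] B ⊗[K] B).restrictScalars R).comp H.val)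
    (((Algebra.TensorProduct.includeRight : B →ₐ[K] B ⊗[K] B).restrictScalars R).comp H.val)
    fun _ _ => Commute.all _ _

@[simp]
theorem tensorVal_tmul (H : Subalgebra R B) (x y : H) :
    tensorVal K H (x ⊗ₜ y) = (x : B) ⊗ₜ[K] (y : B) := by
  simp [tensorVal]

/-- The map `H ⊗[R] (H ⊗[R] H) → B ⊗[K] (B ⊗[K] B)`. -/
def tensorVal₃ (K : Type*) [Field K] [Algebra R K] [HopfAlgebra K B] [IsScalarTower R K B]
    (H : Subalgebra R B) : H ⊗[R] (H ⊗[R] H) →ₐ[R] B ⊗[K] (B ⊗[K] B) :=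
  Algebra.TensorProduct.lift
    (((Algebra.TensorProduct.includeLeft :
      B →ₐ[K] B ⊗[K] (B ⊗[K] B)).restrictScalars R).comp H.val)
    (((Algebra.TensorProduct.includeRight :
      B ⊗[K] B →ₐ[K] B ⊗[K] (B ⊗[K] B)).restrictScalars R).comp (tensorVal K H))
    fun _ _ => Commute.all _ _

@[simp]
theorem tensorVal₃_tmul (H : Subalgebra R B) (x : H) (y : H ⊗[R] H) :
    tensorVal₃ K H (x ⊗ₜ y) = (x : B) ⊗ₜ[K] tensorVal K H y := by
  simp [tensorVal₃]

variable {ι : Type*} {H : Subalgebra R B}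

theorem tensorVal_injective (hRK : Function.Injective (algebraMap R K)) (bH : Basis ι R H)
    (b : Basis ι K B) (hb : ∀ i, (bH i : B) = b i) : Function.Injective (tensorVal K H) :=
  injective_of_basis hRK (bH.tensorProduct bH) (b.tensorProduct b) (tensorVal K H).toLinearMap
    fun ⟨i, j⟩ => by simp [Basis.tensorProduct_apply, hb]

theorem tensorVal₃_injective (hRK : Function.Injective (algebraMap R K)) (bH : Basis ι R H)
    (b : Basis ι K B) (hb : ∀ i, (bH i : B) = b i) : Function.Injective (tensorVal₃ K H) :=
  injective_of_basis hRK (bH.tensorProduct (bH.tensorProduct bH))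
    (b.tensorProduct (b.tensorProduct b)) (tensorVal₃ K H).toLinearMap
    fun ⟨i, j, k⟩ => by simp [Basis.tensorProduct_apply, hb]

theorem exists_comul (hinj : Function.Injective (tensorVal K H))
    (hΔ : ∀ h ∈ H, (Coalgebra.comul (R := K) h : B ⊗[K] B) ∈ (tensorVal K H).range) :
    ∃ Δ : H →ₐ[R] H ⊗[R] H, ∀ h, tensorVal K H (Δ h) = Coalgebra.comul (R := K) (h : B) := by
  let D : H →ₐ[R] (tensorVal K H).range :=
    (((Bialgebra.comulAlgHom K B).restrictScalars R).comp H.val).codRestrict _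
      fun h => hΔ h h.2
  refine ⟨(AlgEquiv.ofInjective _ hinj).symm.toAlgHom.comp D, fun h => ?_⟩
  have := congrArg Subtype.val ((AlgEquiv.ofInjective _ hinj).apply_symm_apply (D h))
  exact this

theorem exists_counit (hRK : Function.Injective (algebraMap R K))
    (hε : ∀ h ∈ H, (Coalgebra.counit (R := K) h : K) ∈ (algebraMap R K).range) :
    ∃ ε : H →ₐ[R] R, ∀ h, algebraMap R K (ε h) = Coalgebra.counit (R := K) (h : B) := by
  let D : H →ₐ[R] (Algebra.ofId R K).range :=
    (((Bialgebra.counitAlgHom K B).restrictScalars R).comp H.val).codRestrict _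
      fun h => hε h h.2
  refine ⟨(AlgEquiv.ofInjective (Algebra.ofId R K) hRK).symm.toAlgHom.comp D, fun h => ?_⟩
  have := congrArg Subtype.val
    ((AlgEquiv.ofInjective (Algebra.ofId R K) hRK).apply_symm_apply (D h))
  exact this


-- This and the next five lemmas say that the inclusions intertwine the operations on `H` with those
-- on `B`. Since the inclusions are injective, each Hopf axiom for `H` then follows from the one for
-- `B`.
set_option synthInstance.maxHeartbeats 100000 in
theorem tensorVal₃_assoc_map (Δ : H →ₐ[R] H ⊗[R] H)
    (hΔ : ∀ h, tensorVal K H (Δ h) = Coalgebra.comul (R := K) (h : B)) (t : H ⊗[R] H) :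
    tensorVal₃ K H (TensorProduct.assoc R H H H (Δ.toLinearMap.rTensor H t)) =
      TensorProduct.assoc K B B B ((Coalgebra.comul (R := K)).rTensor B (tensorVal K H t)) := by
  have key (s : H ⊗[R] H) (h : H) :
      tensorVal₃ K H (TensorProduct.assoc R H H H (s ⊗ₜ h)) =
        TensorProduct.assoc K B B B (tensorVal K H s ⊗ₜ (h : B)) := by
    induction s with
    | zero => simp
    | add x y hx hy => simp only [TensorProduct.add_tmul, map_add, hx, hy]
    | tmul x y => simp
  induction t with
  | zero => simp
  | add x y hx hy => simp only [map_add, hx, hy]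
  | tmul x y => simp [key, hΔ]

theorem tensorVal₃_lTensor (Δ : H →ₐ[R] H ⊗[R] H)
    (hΔ : ∀ h, tensorVal K H (Δ h) = Coalgebra.comul (R := K) (h : B)) (t : H ⊗[R] H) :
    tensorVal₃ K H (Δ.toLinearMap.lTensor H t) =
      (Coalgebra.comul (R := K)).lTensor B (tensorVal K H t) := by
  induction t with
  | zero => simp
  | add x y hx hy => simp only [map_add, hx, hy]
  | tmul x y => simp [hΔ]

theorem val_lid_rTensor (ε : H →ₐ[R] R)
    (hε : ∀ h, algebraMap R K (ε h) = Coalgebra.counit (R := K) (h : B)) (t : H ⊗[R] H) :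
    (TensorProduct.lid R H (ε.toLinearMap.rTensor H t) : B) =
      TensorProduct.lid K B ((Coalgebra.counit (R := K)).rTensor B (tensorVal K H t)) := by
  induction t with
  | zero => simp
  | add x y hx hy => simp only [map_add, hx, hy, Subalgebra.coe_add]
  | tmul x y => simp [← hε]

theorem val_rid_lTensor (ε : H →ₐ[R] R)
    (hε : ∀ h, algebraMap R K (ε h) = Coalgebra.counit (R := K) (h : B)) (t : H ⊗[R] H) :
    (TensorProduct.rid R H (ε.toLinearMap.lTensor H t) : B) =
      TensorProduct.rid K B ((Coalgebra.counit (R := K)).lTensor B (tensorVal K H t)) := by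
  induction t with
  | zero => simp
  | add x y hx hy => simp only [map_add, hx, hy, Subalgebra.coe_add]
  | tmul x y => simp [← hε]

theorem val_mul_rTensor (S : H →ₗ[R] H)
    (hS : ∀ h, (S h : B) = HopfAlgebra.antipode K (h : B)) (t : H ⊗[R] H) :
    (LinearMap.mul' R H (S.rTensor H t) : B) =
      LinearMap.mul' K B ((HopfAlgebra.antipode K).rTensor B (tensorVal K H t)) := by
  induction t with
  | zero => simp
  | add x y hx hy => simp only [map_add, hx, hy, Subalgebra.coe_add]
  | tmul x y => simp [← hS]

theorem val_mul_lTensor (S : H →ₗ[R] H)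
    (hS : ∀ h, (S h : B) = HopfAlgebra.antipode K (h : B)) (t : H ⊗[R] H) :
    (LinearMap.mul' R H (S.lTensor H t) : B) =
      LinearMap.mul' K B ((HopfAlgebra.antipode K).lTensor B (tensorVal K H t)) := by
  induction t with
  | zero => simp
  | add x y hx hy => simp only [map_add, hx, hy, Subalgebra.coe_add]
  | tmul x y => simp [← hS]

/-- The Hopf algebra structure on a subalgebra `H` of `B` restricting the one of `B`. -/
abbrev hopfOfVal (h₃ : Function.Injective (tensorVal₃ K H))
    (Δ : H →ₐ[R] H ⊗[R] H)
    (hΔ : ∀ h, tensorVal K H (Δ h) = Coalgebra.comul (R := K) (h : B))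
    (ε : H →ₐ[R] R)
    (hε : ∀ h, algebraMap R K (ε h) = Coalgebra.counit (R := K) (h : B))
    (S : H →ₗ[R] H)
    (hS : ∀ h, (S h : B) = HopfAlgebra.antipode K (h : B)) : HopfAlgebra R H :=
  letI : Coalgebra R H :=
    { comul := Δ.toLinearMap
      counit := ε.toLinearMap
      coassoc := LinearMap.ext fun h => h₃ <| by
        simp [tensorVal₃_assoc_map Δ hΔ, tensorVal₃_lTensor Δ hΔ, hΔ]
      rTensor_counit_comp_comul := LinearMap.ext fun h =>
        (TensorProduct.lid R H).injective <| Subtype.ext <| by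
          simp [val_lid_rTensor ε hε, hΔ]
      lTensor_counit_comp_comul := LinearMap.ext fun h =>
        (TensorProduct.rid R H).injective <| Subtype.ext <| by
          simp [val_rid_lTensor ε hε, hΔ] }
  letI : Bialgebra R H :=
    Bialgebra.mk' _ _ (map_one ε) (map_mul ε _ _) (map_one Δ) (map_mul Δ _ _)
  { antipode := S
    mul_antipode_rTensor_comul := LinearMap.ext fun h => Subtype.ext <| by
      have : (LinearMap.mul' R H (S.rTensor H (Δ h)) : B) = (algebraMap R H (ε h) : H) := by
        rw [val_mul_rTensor S hS, hΔ]
        simp [← hε, ← IsScalarTower.algebraMap_apply R K B]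
      exact this
    mul_antipode_lTensor_comul := LinearMap.ext fun h => Subtype.ext <| by
      have : (LinearMap.mul' R H (S.lTensor H (Δ h)) : B) = (algebraMap R H (ε h) : H) := by
        rw [val_mul_lTensor S hS, hΔ]
        simp [← hε, ← IsScalarTower.algebraMap_apply R K B]
      exact this }

/-- A subalgebra with an `R`-basis that is a `K`-basis of `B`, and stable under the Hopf algebra
operations of `B`, is a Hopf order. -/
theorem isHopfOrder_of_basis [Finite ι] (hRK : Function.Injective (algebraMap R K))
    (bH : Basis ι R H)
    (b : Basis ι K B) (hb : ∀ i, (bH i : B) = b i)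
    (hΔ : ∀ h ∈ H, (Coalgebra.comul (R := K) h : B ⊗[K] B) ∈ (tensorVal K H).range)
    (hε : ∀ h ∈ H, (Coalgebra.counit (R := K) h : K) ∈ (algebraMap R K).range)
    (hS : ∀ h ∈ H, HopfAlgebra.antipode K h ∈ H) : IsHopfOrder R K H := by
  have h₂ := tensorVal_injective hRK bH b hb
  obtain ⟨Δ, hΔ⟩ := exists_comul h₂ hΔ
  obtain ⟨ε, hε⟩ := exists_counit hRK hε
  let S : H →ₗ[R] H :=
    (((HopfAlgebra.antipode K (A := B)).restrictScalars R).comp H.val.toLinearMap).codRestrict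
      (Subalgebra.toSubmodule H) fun h => hS h h.2
  have hS : ∀ h, (S h : B) = HopfAlgebra.antipode K (h : B) := fun h => rfl
  refine ⟨.of_basis bH, .of_basis bH,
    hopfOfVal (tensorVal₃_injective hRK bH b hb) Δ hΔ ε hε S hS, rfl, ?_⟩
  let _ := hopfOfVal (tensorVal₃_injective hRK bH b hb) Δ hΔ ε hε S hS
  let f : K ⊗[R] H →ₐ[K] B :=
    Algebra.TensorProduct.lift (Algebra.ofId K B) H.val fun _ _ => Commute.all _ _
  have hf : Function.Bijective f := by
    -- `f` carries the base-changed basis to `b`, so it agrees with a linear equivalence.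
    let e := (bH.baseChange K).equiv b (Equiv.refl ι)
    have : f.toLinearMap = e.toLinearMap := (bH.baseChange K).ext fun i => by
      have : e (bH.baseChange K i) = b i := Basis.equiv_apply ..
      rw [LinearEquiv.coe_coe, this]
      simp [f, hb]
    have h' : (f : K ⊗[R] H → B) = e := congrArg DFunLike.coe this
    rw [h']
    exact e.bijective
  refine ⟨.ofAlgEquiv (AlgEquiv.ofBijective f hf) ?_ ?_, fun h => ?_⟩
  · ext h
    change Coalgebra.counit (R := K) (f (1 ⊗ₜ h)) = ε h • (1 : K)
    simp [f, ← hε, Algebra.algebraMap_eq_smul_one]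
  · ext h
    -- The comultiplication of `K ⊗ H` is `Δ` followed by the interchange of tensor factors; `f ⊗ f`
    -- turns this into the inclusion of `H ⊗ H`.
    have key (t : H ⊗[R] H) : Algebra.TensorProduct.map f f
        (TensorProduct.AlgebraTensorModule.tensorTensorTensorComm R K R K K K H H
          ((1 ⊗ₜ 1) ⊗ₜ t)) = tensorVal K H t := by
      induction t with
      | zero => rw [TensorProduct.tmul_zero, LinearEquiv.map_zero, map_zero, map_zero]
      | add x y hx hy => rw [TensorProduct.tmul_add, LinearEquiv.map_add, map_add, map_add, hx, hy]
      | tmul x y => simp [f]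
    have h1 : f (1 ⊗ₜ h) = h := by simp [f]
    refine (key (Δ h)).trans ?_
    rw [hΔ]
    change _ = Coalgebra.comul (R := K) (f (1 ⊗ₜ h))
    rw [h1]
  · change f (1 ⊗ₜ h) = h
    simp [f]

end Criterion

/-! ### Truncated exponentials with indeterminate exponent -/

section TruncatedExponential

open Polynomial

variable (p : ℕ) {D E : Type*} [CommRing D] [CharP D p] [CommRing E] [CharP E p]

/-- `y (y - 1) ⋯ (y - m + 1) / m!` in a ring of characteristic `p`, for `m < p`. -/
def charBinom (y : D) (m : ℕ) : D :=
  (∏ j ∈ Finset.range m, (y - (j : D))) * ZMod.castHom (dvd_refl p) D ((m.factorial : ZMod p)⁻¹)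

/-- The truncated exponential `x^{[y]}` with `x` and `y` in a ring of characteristic `p`. -/
def ringTruncExp (x y : D) : D :=
  ∑ m ∈ Finset.range p, charBinom p y m * (x - 1) ^ m

/-- The inverse factorial comes from `ZMod p`, which has at most one map to any ring. This
naturality lets the exponent be an indeterminate that is shifted and specialised later. -/
theorem map_charBinom (f : D →+* E) (y : D) (m : ℕ) :
    f (charBinom p y m) = charBinom p (f y) m := by
  have : f.comp (ZMod.castHom (dvd_refl p) D) = ZMod.castHom (dvd_refl p) E :=
    Subsingleton.elim _ _
  simp only [charBinom, map_mul, map_prod, map_sub, map_natCast, ← this, RingHom.comp_apply]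

theorem map_ringTruncExp (f : D →+* E) (x y : D) :
    f (ringTruncExp p x y) = ringTruncExp p (f x) (f y) := by
  simp [ringTruncExp, map_charBinom]

@[simp]
theorem charBinom_zero_right (y : D) : charBinom p y 0 = 1 := by
  rcases eq_or_ne p 1 with rfl | hp
  · have := CharP.CharOne.subsingleton (R := D)
    exact Subsingleton.elim _ _
  · simp [charBinom]

variable [hp : Fact p.Prime]

theorem charBinom_one_right (y : D) : charBinom p y 1 = y := by
  simp [charBinom]

theorem charBinom_eq_genBinom {K : Type*} [Field K] [CharP K p] (y : K) (m : ℕ) :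
    charBinom p y m = genBinom y m := by
  rw [charBinom, genBinom, map_inv₀, map_natCast, div_eq_mul_inv]

theorem ringTruncExp_algebraMap {K : Type*} [Field K] [CharP K p] [Algebra K D] (x : D) (y : K) :
    ringTruncExp p x (algebraMap K D y) = truncExp p x y := by
  simp [ringTruncExp, truncExp, ← map_charBinom, charBinom_eq_genBinom, Algebra.smul_def]

omit hp in
theorem charBinom_zero_left (m : ℕ) : charBinom p (0 : D) (m + 1) = 0 := by
  simp [charBinom, Finset.prod_range_succ']

theorem charBinom_add_one (y : D) {m : ℕ} (hm : m + 1 < p) :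
    charBinom p (y + 1) (m + 1) = charBinom p y (m + 1) + charBinom p y m := by
  have h0 : ((m + 1 : ℕ) : ZMod p) ≠ 0 := by
    rw [Ne, ZMod.natCast_eq_zero_iff]
    exact Nat.not_dvd_of_pos_of_lt m.succ_pos hm
  have h1 : ((m.factorial : ZMod p)⁻¹) = (m + 1 : ℕ) * (((m + 1).factorial : ZMod p)⁻¹) := by
    rw [Nat.factorial_succ, Nat.cast_mul, mul_inv, mul_inv_cancel_left₀ h0]
  have h2 : ∏ k ∈ Finset.range m, (y + 1 - ((k + 1 : ℕ) : D)) =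
      ∏ k ∈ Finset.range m, (y - (k : D)) :=
    Finset.prod_congr rfl fun k _ => by push_cast; ring
  simp only [charBinom]
  rw [h1, map_mul, map_natCast, Finset.prod_range_succ', h2, Finset.prod_range_succ]
  push_cast
  ring

/-- Pascal's rule; the term lost by truncation is a multiple of `(x - 1)^p = 0`. -/
theorem ringTruncExp_add_one {x : D} (hx : (x - 1) ^ p = 0) (y : D) :
    ringTruncExp p x (y + 1) = x * ringTruncExp p x y := by
  obtain ⟨q, hq⟩ : ∃ q, p = q + 1 := ⟨p - 1, (Nat.sub_add_cancel hp.out.one_le).symm⟩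
  have hr := congrArg Finset.range hq
  have h1 : ringTruncExp p x (y + 1) =
      ∑ m ∈ Finset.range q, (charBinom p y (m + 1) + charBinom p y m) * (x - 1) ^ (m + 1) + 1 := by
    rw [ringTruncExp, hr, Finset.sum_range_succ']
    congr 1
    · refine Finset.sum_congr rfl fun m hm => ?_
      rw [charBinom_add_one p y (by rw [Finset.mem_range] at hm; omega)]
    · simp
  have h2 : ringTruncExp p x y =
      ∑ m ∈ Finset.range q, charBinom p y (m + 1) * (x - 1) ^ (m + 1) + 1 := by
    rw [ringTruncExp, hr, Finset.sum_range_succ']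
    simp
  have h3 : (x - 1) * ringTruncExp p x y =
      ∑ m ∈ Finset.range q, charBinom p y m * (x - 1) ^ (m + 1) := by
    have h4 : (x - 1) * (x - 1) ^ q = 0 := by rw [← pow_succ', ← hq, hx]
    rw [ringTruncExp, hr, Finset.sum_range_succ, mul_add, mul_left_comm, h4, mul_zero,
      add_zero, Finset.mul_sum]
    exact Finset.sum_congr rfl fun m _ => by ring
  have h5 : x * ringTruncExp p x y = (x - 1) * ringTruncExp p x y + ringTruncExp p x y := by ring
  rw [h5, h3, h1, h2]
  simp only [add_mul, Finset.sum_add_distrib]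
  ring

theorem ringTruncExp_zero (x : D) : ringTruncExp p x 0 = 1 := by
  obtain ⟨q, hq⟩ : ∃ q, p = q + 1 := ⟨p - 1, (Nat.sub_add_cancel hp.out.one_le).symm⟩
  have hr := congrArg Finset.range hq
  rw [ringTruncExp, hr, Finset.sum_range_succ']
  simp [charBinom_zero_left]

theorem ringTruncExp_pow {x : D} (hx : (x - 1) ^ p = 0) (y : D) :
    ringTruncExp p x y ^ p = 1 := by
  obtain ⟨q, hq⟩ : ∃ q, p = q + 1 := ⟨p - 1, (Nat.sub_add_cancel hp.out.one_le).symm⟩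
  have hr := congrArg Finset.range hq
  have h : ringTruncExp p x y ^ p = ∑ m ∈ Finset.range p, (charBinom p y m * (x - 1) ^ m) ^ p := by
    rw [ringTruncExp, sum_pow_char]
  rw [h, hr, Finset.sum_range_succ']
  simp [mul_pow, ← pow_mul, pow_mul', hx, zero_pow]

theorem ringTruncExp_of_mul_self {q : D} (hq : q * q = 0) (y : D) :
    ringTruncExp p (1 + q) y = 1 + y * q := by
  obtain ⟨k, hk⟩ : ∃ k, p = k + 1 + 1 :=
    ⟨p - 2, (Nat.sub_add_cancel hp.out.two_le).symm⟩
  have hr := congrArg Finset.range hk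
  rw [ringTruncExp, hr, Finset.sum_range_succ', Finset.sum_range_succ']
  have h (m : ℕ) : (1 + q - 1) ^ (m + 1 + 1) = 0 := by
    rw [pow_succ, pow_succ, mul_assoc]; simp [hq]
  simp only [h, mul_zero, Finset.sum_const_zero]
  simp [charBinom_one_right]
  ring

/-- The binomial of index `m` has `m` linear factors, each paired with one copy of `x - 1`, so every
power of `X` comes with an element of `I`. -/
theorem ringTruncExp_mem_reesAlgebra {I : Ideal D} {x : D} (hx : x - 1 ∈ I) :
    ringTruncExp p (C x) (X : D[X]) ∈ reesAlgebra I := by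
  refine Subalgebra.sum_mem _ fun m _ => ?_
  have h1 : charBinom p (X : D[X]) m * (C x - 1) ^ m =
      (∏ j ∈ Finset.range m, ((X - (j : D[X])) * C (x - 1))) *
        C (ZMod.castHom (dvd_refl p) D ((m.factorial : ZMod p)⁻¹)) := by
    have : (C : D →+* D[X]).comp (ZMod.castHom (dvd_refl p) D) = ZMod.castHom (dvd_refl p) D[X] :=
      Subsingleton.elim _ _
    rw [charBinom, ← this, Finset.prod_mul_distrib, Finset.prod_const, Finset.card_range]
    simp
    ring
  rw [h1]
  refine Subalgebra.mul_mem _ (Subalgebra.prod_mem _ fun j _ => ?_)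
    (Subalgebra.algebraMap_mem (reesAlgebra I) _)
  have h2 : (X - (j : D[X])) * C (x - 1) = monomial 1 (x - 1) - C ((j : D) * (x - 1)) := by
    rw [← C_mul_X_eq_monomial]
    simp
    ring
  rw [h2]
  exact Subalgebra.sub_mem _ (reesAlgebra.monomial_mem.2 (by simpa using hx))
    (Subalgebra.algebraMap_mem (reesAlgebra I) _)

/-- In degree `k + 1`, the `X^k` coefficient of `f(X + 1) - f(X)` is `k + 1` times the leading one,
and `k + 1` is a unit unless `p` divides it. No domain hypothesis is needed. -/
theorem dvd_natDegree_of_comp_add_one {f : D[X]} (hf : f.comp (X + 1) = f) :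
    p ∣ f.natDegree := by
  by_contra hd
  obtain ⟨k, hk⟩ : ∃ k, f.natDegree = k + 1 :=
    Nat.exists_eq_succ_of_ne_zero fun h => hd (h ▸ dvd_zero p)
  have h1 : (taylor 1 f).coeff k = f.coeff k := by
    rw [taylor_apply, map_one, hf]
  have h2 : (hasseDeriv k f).natDegree < 2 := by
    have := natDegree_hasseDeriv_le f k
    omega
  rw [taylor_coeff, eval_eq_sum_range' h2] at h1
  simp only [Finset.sum_range_succ, Finset.sum_range_zero, hasseDeriv_coeff] at h1
  have h3 : ((k + 1 : ℕ) : D) * f.coeff (k + 1) = 0 := by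
    simp only [zero_add, Nat.choose_self, one_pow, mul_one, Nat.cast_one, one_mul,
      add_comm 1 k] at h1
    simpa using h1
  have h4 : IsUnit ((k + 1 : ℕ) : D) :=
    (CharP.isUnit_natCast_iff hp.out).2 (hk ▸ hd)
  rw [h4.mul_right_eq_zero, ← hk, ← leadingCoeff, leadingCoeff_eq_zero] at h3
  simp [h3] at hk

/-- The degree is `0` or `p`. Subtracting the multiple of the invariant polynomial `X^p - X` that
kills the `X^p` coefficient leaves a constant with value `0` at `0`. -/
theorem eq_C_mul_of_comp_add_one {f : D[X]} (hdeg : f.natDegree < 2 * p)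
    (hf : f.comp (X + 1) = f) (h0 : f.eval 0 = 0) : f = C (f.coeff p) * (X ^ p - X) := by
  set c := f.coeff p
  set g := f - C c * (X ^ p - X) with hg
  have hp1 := hp.out.one_lt
  have hgper : g.comp (X + 1) = g := by
    simp only [hg, sub_comp, mul_comp, C_comp, pow_comp, X_comp, hf, add_pow_char, one_pow]
    ring
  have hfle : f.natDegree ≤ p := by
    obtain ⟨m, hm⟩ := dvd_natDegree_of_comp_add_one p hf
    rw [hm] at hdeg ⊢
    have : m < 2 := by nlinarith
    nlinarith
  have hgle : g.natDegree ≤ p := by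
    refine (natDegree_sub_le _ _).trans (max_le hfle ?_)
    refine (natDegree_C_mul_le _ _).trans ((natDegree_sub_le _ _).trans (max_le ?_ ?_))
    · exact natDegree_X_pow_le p
    · exact natDegree_X_le.trans hp1.le
  have hgp : g.coeff p = 0 := by
    simp [hg, c, coeff_X, hp1.ne]
  have hg0 : g.natDegree = 0 := by
    obtain ⟨m, hm⟩ := dvd_natDegree_of_comp_add_one p hgper
    by_contra hne
    have h1 : g.natDegree = p :=
      le_antisymm hgle (Nat.le_of_dvd (Nat.pos_of_ne_zero hne) ⟨m, hm⟩)
    rw [← h1, ← leadingCoeff, leadingCoeff_eq_zero] at hgp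
    simp [hgp] at hne
  have h2 : g = 0 := by
    rw [eq_C_of_natDegree_eq_zero hg0, coeff_zero_eq_eval_zero]
    simp [hg, h0, hp.out.ne_zero]
  exact sub_eq_zero.1 h2

theorem sub_one_pow_eq_zero_of_mul {x y : D} (hx : (x - 1) ^ p = 0) (hy : (y - 1) ^ p = 0) :
    (x * y - 1) ^ p = 0 := by
  rw [sub_pow_char, one_pow, sub_eq_zero] at *
  rw [mul_pow, hx, hy, one_mul]

theorem exists_ringTruncExp_mul {x y : D} (hx : (x - 1) ^ p = 0) (hy : (y - 1) ^ p = 0) :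
    ∃ r ∈ Ideal.span {x - 1, y - 1} ^ p, r * r = 0 ∧
      ringTruncExp p (C (x * y)) (X : D[X]) =
        ringTruncExp p (C x) X * ringTruncExp p (C y) X * (1 + C r * (X ^ p - X)) := by
  set I := Ideal.span {x - 1, y - 1} with hI
  have hI0 : I ^ (2 * p) = ⊥ := by
    rw [eq_bot_iff, two_mul, hI, Ideal.span_insert]
    refine (Ideal.sup_pow_add_le_pow_sup_pow).trans ?_
    simp [Ideal.span_singleton_pow, hx, hy]
  have hxI : x - 1 ∈ I := Ideal.subset_span (by simp)
  have hyI : y - 1 ∈ I := Ideal.subset_span (by simp)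
  have hxyI : x * y - 1 ∈ I := by
    have : x * y - 1 = x * (y - 1) + (x - 1) := by ring
    rw [this]
    exact I.add_mem (I.mul_mem_left _ hyI) hxI
  have hnil {z : D} (hz : (z - 1) ^ p = 0) : (C z - 1 : D[X]) ^ p = 0 := by
    rw [← C_1, ← C_sub, ← C_pow, hz, C_0]
  have hxy := sub_one_pow_eq_zero_of_mul p hx hy
  obtain ⟨q, hq⟩ : ∃ q, p = q + 1 := ⟨p - 1, (Nat.sub_add_cancel hp.out.one_le).symm⟩
  -- The `p`-th power of `z^{[X]}` is `1`, so its power `q = p - 1` serves as an inverse and no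
  -- division is needed in `f`.
  have hinv {z : D} (hz : (z - 1) ^ p = 0) :
      ringTruncExp p (C z) (X : D[X]) * ringTruncExp p (C z) (X : D[X]) ^ q = 1 := by
    rw [← pow_succ', ← hq, ringTruncExp_pow p (hnil hz)]
  set f : D[X] := ringTruncExp p (C (x * y)) X * ringTruncExp p (C x) X ^ q *
    ringTruncExp p (C y) X ^ q - 1 with hf
  have hfI : f ∈ reesAlgebra I :=
    Subalgebra.sub_mem _ (Subalgebra.mul_mem _ (Subalgebra.mul_mem _
      (ringTruncExp_mem_reesAlgebra p hxyI)
      (Subalgebra.pow_mem _ (ringTruncExp_mem_reesAlgebra p hxI) _))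
      (Subalgebra.pow_mem _ (ringTruncExp_mem_reesAlgebra p hyI) _)) (Subalgebra.one_mem _)
  have hdeg : f.natDegree < 2 * p := by
    -- Otherwise the leading coefficient lies in `I ^ (2 * p) = 0`.
    by_contra! hm
    have := Ideal.pow_le_pow_right (I := I) hm (hfI f.natDegree)
    rw [hI0, Ideal.mem_bot, ← leadingCoeff, leadingCoeff_eq_zero] at this
    rw [this, natDegree_zero] at hm
    have := hp.out.pos
    omega
  have hcomp (z : D) (hz : (z - 1) ^ p = 0) : (ringTruncExp p (C z) (X : D[X])).comp (X + 1) =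
      C z * ringTruncExp p (C z) X := by
    rw [← ringTruncExp_add_one p (hnil hz)]
    simpa using map_ringTruncExp p (compRingHom (X + 1 : D[X])) (C z) X
  have heval (z : D) : (ringTruncExp p (C z) (X : D[X])).eval 0 = 1 := by
    rw [← ringTruncExp_zero p z]
    simpa using map_ringTruncExp p (evalRingHom (0 : D)) (C z) X
  have hz1 {z : D} (hz : (z - 1) ^ p = 0) : C z * C z ^ q = 1 := by
    rw [sub_pow_char, one_pow, sub_eq_zero] at hz
    rw [← pow_succ', ← hq, ← C_pow, hz, C_1]
  have hper : f.comp (X + 1) = f := by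
    simp only [hf, sub_comp, mul_comp, pow_comp, one_comp, hcomp _ hx, hcomp _ hy, hcomp _ hxy]
    rw [C_mul]
    linear_combination (ringTruncExp p (C x * C y) X * ringTruncExp p (C x) X ^ q *
      ringTruncExp p (C y) X ^ q) * (C y * C y ^ q * hz1 hx + hz1 hy)
  have hf0 : f.eval 0 = 0 := by simp [hf, heval, -map_mul]
  have key := eq_C_mul_of_comp_add_one p hdeg hper hf0
  refine ⟨f.coeff p, hfI p, ?_, ?_⟩
  · have : f.coeff p * f.coeff p ∈ I ^ (2 * p) := by
      rw [two_mul, pow_add]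
      exact Ideal.mul_mem_mul (hfI p) (hfI p)
    rwa [hI0, Ideal.mem_bot] at this
  · rw [← key, hf]
    linear_combination (-ringTruncExp p (C (x * y)) X) *
      (ringTruncExp p (C y) X * ringTruncExp p (C y) X ^ q * hinv hx + hinv hy)

end TruncatedExponential

/-! ### Exponents in `K` and congruences modulo powers of the uniformizer -/

section Congruence

variable {K : Type*} [Field K] {C C' : Type*} [CommRing C] [Algebra K C] [CommRing C'] [Algebra K C']

theorem map_truncExp (p : ℕ) (f : C →ₐ[K] C') (x : C) (y : K) :
    f (truncExp p x y) = truncExp p (f x) y := by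
  simp [truncExp]

variable (p : ℕ) [hp : Fact p.Prime] [CharP K p] [CharP C p]

theorem truncExp_pow {x : C} (hx : x ^ p = 1) (y : K) : truncExp p x y ^ p = 1 := by
  rw [← ringTruncExp_algebraMap, ringTruncExp_pow]
  rw [sub_pow_char, hx, one_pow, sub_self]

theorem truncExp_of_mul_self {q : C} (hq : q * q = 0) (y : K) :
    truncExp p (1 + q) y = 1 + y • q := by
  rw [← ringTruncExp_algebraMap, ringTruncExp_of_mul_self p hq, Algebra.smul_def]

theorem truncExp_one (y : K) : truncExp p (1 : C) y = 1 := by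
  simpa using truncExp_of_mul_self p (mul_zero (0 : C)) y

/-- Specialises `X` to `a`. The exponent need not come from `D`, so `D` may be an order; and `r` is
independent of `a`, which later lets the corrections for `μ` and `α` combine. -/
theorem exists_truncExp_mul {D : Type*} [CommRing D] [CharP D p] (φ : D →+* C) {x y : D}
    (hx : x ^ p = 1) (hy : y ^ p = 1) :
    ∃ r ∈ Ideal.span {x - 1, y - 1} ^ p, r * r = 0 ∧ ∀ a : K,
      truncExp p (φ x * φ y) a = truncExp p (φ x) a * truncExp p (φ y) a * (1 + wp p a • φ r) := by
  obtain ⟨r, hr, hrr, h⟩ := exists_ringTruncExp_mul p (x := x) (y := y)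
    (by rw [sub_pow_char, hx, one_pow, sub_self]) (by rw [sub_pow_char, hy, one_pow, sub_self])
  refine ⟨r, hr, hrr, fun a => ?_⟩
  have := congrArg (Polynomial.eval₂RingHom φ (algebraMap K C a)) h
  simp only [map_mul, map_ringTruncExp, map_add, map_one, map_sub, map_pow,
    Polynomial.coe_eval₂RingHom, Polynomial.eval₂_C, Polynomial.eval₂_X,
    ringTruncExp_algebraMap] at this
  rw [this, Algebra.smul_def, wp, map_sub, map_pow, mul_comm (φ r)]

/-- Here `y - 1` is a multiple of `x - 1`, so the correction lies in `((x - 1)^p) = 0`. -/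
theorem truncExp_mul_of_mul_eq_one {x y : C} (hx : x ^ p = 1) (hxy : x * y = 1) (a : K) :
    truncExp p x a * truncExp p y a = 1 := by
  have hy : y ^ p = 1 := by
    have := congrArg (· ^ p) hxy
    simpa [mul_pow, hx] using this
  obtain ⟨r, hr, -, h⟩ := exists_truncExp_mul (K := K) p (RingHom.id C) hx hy
  have hspan : Ideal.span {x - 1, y - 1} ≤ Ideal.span {x - 1} := by
    rw [Ideal.span_le, Set.insert_subset_iff, Set.singleton_subset_iff]
    refine ⟨Ideal.mem_span_singleton_self _, Ideal.mem_span_singleton.2 ⟨-y, ?_⟩⟩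
    linear_combination hxy
  have hr0 := Ideal.pow_right_mono hspan p hr
  rw [Ideal.span_singleton_pow, sub_pow_char, hx, one_pow, sub_self, Ideal.mem_span_singleton,
    zero_dvd_iff] at hr0
  simpa [hr0, hxy, truncExp_one] using (h a).symm

variable {R : Subring K} [Algebra R C] [IsScalarTower R K C] [Algebra R C'] [IsScalarTower R K C']

/-- The congruence `z ≡ 1` modulo `t • D`. -/
def CongrOne (D : Subalgebra R C) (t : K) (z : C) : Prop :=
  ∃ d ∈ D, z = 1 + t • d

variable {D : Subalgebra R C} {t : K}

omit [IsScalarTower R K C] in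
theorem congrOne_one : CongrOne D t 1 := ⟨0, D.zero_mem, by simp⟩

theorem smul_mem_of_mem (ht : t ∈ R) {d : C} (hd : d ∈ D) : t • d ∈ D := by
  have : t • d = (⟨t, ht⟩ : R) • d := (algebraMap_smul K (⟨t, ht⟩ : R) d)
  rw [this]
  exact D.smul_mem hd _

theorem CongrOne.mem (ht : t ∈ R) {z : C} (hz : CongrOne D t z) : z ∈ D := by
  obtain ⟨d, hd, rfl⟩ := hz
  exact D.add_mem D.one_mem (smul_mem_of_mem ht hd)

theorem CongrOne.mul (ht : t ∈ R) {z w : C} (hz : CongrOne D t z) (hw : CongrOne D t w) :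
    CongrOne D t (z * w) := by
  obtain ⟨d, hd, rfl⟩ := hz
  obtain ⟨e, he, rfl⟩ := hw
  refine ⟨d + e + t • (d * e),
    D.add_mem (D.add_mem hd he) (smul_mem_of_mem ht (D.mul_mem hd he)), ?_⟩
  simp only [Algebra.smul_def]
  ring

theorem CongrOne.pow (ht : t ∈ R) {z : C} (hz : CongrOne D t z) (n : ℕ) :
    CongrOne D t (z ^ n) := by
  induction n with
  | zero => simpa using congrOne_one
  | succ n ih => rw [pow_succ]; exact ih.mul ht hz

omit [IsScalarTower R K C] [IsScalarTower R K C'] in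
theorem CongrOne.map {D' : Subalgebra R C'} (f : C →ₐ[K] C') (hf : ∀ d ∈ D, f d ∈ D') {z : C}
    (hz : CongrOne D t z) : CongrOne D' t (f z) := by
  obtain ⟨d, hd, rfl⟩ := hz
  exact ⟨f d, hf d hd, by simp⟩

omit [IsScalarTower R K C] in
theorem CongrOne.inv_smul_mem (ht : t ≠ 0) {z : C} (hz : CongrOne D t z) :
    t⁻¹ • (z - 1) ∈ D := by
  obtain ⟨d, hd, rfl⟩ := hz
  rwa [add_sub_cancel_left, inv_smul_smul₀ ht]

/-- The deviation of the truncated exponential from multiplicativity on elements congruent to `1`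
modulo `t`. -/
theorem exists_truncExp_mul_of_congrOne (ht : t ∈ R) {x y : C} (hx : x ^ p = 1)
    (hy : y ^ p = 1) (hxD : CongrOne D t x) (hyD : CongrOne D t y) :
    ∃ q ∈ D, (t ^ p • q) * (t ^ p • q) = 0 ∧ ∀ a : K,
      truncExp p (x * y) a = truncExp p x a * truncExp p y a * (1 + wp p a • t ^ p • q) := by
  have : CharP D p := RingHom.charP D.val.toRingHom Subtype.val_injective p
  let tD : D := algebraMap R D ⟨t, ht⟩
  have htD (d : D) : ((tD * d : D) : C) = t • (d : C) := by
    have : tD * d = (⟨t, ht⟩ : R) • d := (Algebra.smul_def _ _).symm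
    rw [this]
    exact (algebraMap_smul K (⟨t, ht⟩ : R) (d : C)).symm
  have hsub {z : C} (hz : CongrOne D t z) :
      (⟨z, hz.mem ht⟩ - 1 : D) ∈ Ideal.span {tD} := by
    obtain ⟨d, hd, hz'⟩ := id hz
    refine Ideal.mem_span_singleton.2 ⟨⟨d, hd⟩, Subtype.ext ?_⟩
    rw [htD]
    simp [hz']
  obtain ⟨r, hr, hrr, h⟩ := exists_truncExp_mul (K := K) p D.val.toRingHom
    (x := ⟨x, hxD.mem ht⟩) (y := ⟨y, hyD.mem ht⟩) (Subtype.ext (by simpa using hx))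
    (Subtype.ext (by simpa using hy))
  have hspan : Ideal.span {(⟨x, hxD.mem ht⟩ - 1 : D), (⟨y, hyD.mem ht⟩ - 1 : D)} ≤
      Ideal.span {tD} := by
    rw [Ideal.span_le, Set.insert_subset_iff, Set.singleton_subset_iff]
    exact ⟨hsub hxD, hsub hyD⟩
  have hr' := Ideal.pow_right_mono hspan p hr
  rw [Ideal.span_singleton_pow, Ideal.mem_span_singleton] at hr'
  obtain ⟨d, hd⟩ := hr'
  have hpow (n : ℕ) : ((tD ^ n * d : D) : C) = t ^ n • (d : C) := by
    induction n with
    | zero => simp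
    | succ n ih => rw [pow_succ', mul_assoc, htD, ih, pow_succ', mul_smul]
  have hrd : (r : C) = t ^ p • (d : C) := by rw [hd, hpow]
  refine ⟨d, d.2, ?_, fun a => ?_⟩
  · rw [← hrd]
    exact congrArg Subtype.val hrr
  · rw [← hrd]
    exact h a

end Congruence

/-! ### Monomial spanning sets and generation of the group algebra -/

section Monomials

theorem toSubmodule_adjoin_eq_span_monomials {S A : Type*} [CommRing S] [CommRing A] [Algebra S A]
    {p : ℕ} {x y z : A} (hx : x ^ p = 0) (hy : y ^ p = 0) (hz : z ^ p = 0) :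
    Subalgebra.toSubmodule (Algebra.adjoin S {x, y, z}) =
      Submodule.span S (Set.range fun i : Fin p × Fin p × Fin p =>
        x ^ (i.1 : ℕ) * y ^ (i.2.1 : ℕ) * z ^ (i.2.2 : ℕ)) := by
  apply le_antisymm
  · rw [Algebra.adjoin_eq_span, Submodule.span_le]
    intro w hw
    have : ∃ a b c : ℕ, w = x ^ a * y ^ b * z ^ c := by
      induction hw using Submonoid.closure_induction with
      | mem w hw =>
        rcases hw with rfl | rfl | rfl
        · exact ⟨1, 0, 0, by simp⟩
        · exact ⟨0, 1, 0, by simp⟩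
        · exact ⟨0, 0, 1, by simp⟩
      | one => exact ⟨0, 0, 0, by simp⟩
      | mul u v _ _ hu hv =>
        obtain ⟨a, b, c, rfl⟩ := hu
        obtain ⟨a', b', c', rfl⟩ := hv
        exact ⟨a + a', b + b', c + c', by ring⟩
    obtain ⟨a, b, c, rfl⟩ := this
    by_cases ha : p ≤ a
    · simp [pow_eq_zero_of_le ha hx]
    by_cases hb : p ≤ b
    · simp [pow_eq_zero_of_le hb hy]
    by_cases hc : p ≤ c
    · simp [pow_eq_zero_of_le hc hz]
    exact Submodule.subset_span ⟨(⟨a, by omega⟩, ⟨b, by omega⟩, ⟨c, by omega⟩), rfl⟩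
  · rw [Submodule.span_le]
    rintro _ ⟨i, rfl⟩
    have h (w : A) (hw : w ∈ ({x, y, z} : Set A)) : w ∈ Algebra.adjoin S {x, y, z} :=
      Algebra.subset_adjoin hw
    exact Subalgebra.mul_mem _ (Subalgebra.mul_mem _ (Subalgebra.pow_mem _ (h x (by simp)) _)
      (Subalgebra.pow_mem _ (h y (by simp)) _)) (Subalgebra.pow_mem _ (h z (by simp)) _)

theorem truncExp_mem {K C : Type*} [Field K] [CommRing C] [Algebra K C] (p : ℕ)
    (A : Subalgebra K C) {x : C} (hx : x ∈ A) (a : K) : truncExp p x a ∈ A :=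
  A.sum_mem fun _ _ => A.smul_mem (A.pow_mem (A.sub_mem hx A.one_mem) _) _

theorem eq_top_of_of_mem {K G : Type*} [Field K] [CommGroup G] [Finite G] {s : Set G}
    (hs : Subgroup.closure s = ⊤) (A : Subalgebra K (MonoidAlgebra K G))
    (hA : ∀ g ∈ s, MonoidAlgebra.of K G g ∈ A) : A = ⊤ := by
  have h (g : G) : MonoidAlgebra.of K G g ∈ A := by
    have hg : g ∈ Subgroup.closure s := hs ▸ Subgroup.mem_top g
    induction hg using Subgroup.closure_induction with
    | mem g hg => exact hA g hg
    | one => rw [map_one]; exact A.one_mem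
    | mul a b _ _ ha hb => rw [map_mul]; exact A.mul_mem ha hb
    | inv a _ ha =>
      have : a⁻¹ = a ^ (orderOf a - 1) := by
        rw [inv_eq_iff_mul_eq_one, ← pow_succ', Nat.sub_add_cancel (orderOf_pos a),
          pow_orderOf_eq_one]
      rw [this, map_pow]
      exact A.pow_mem ha _
  rw [eq_top_iff]
  intro f _
  induction f using MonoidAlgebra.induction_on with
  | of g => exact h g
  | add f g hf hg => exact A.add_mem (hf trivial) (hg trivial)
  | smul r f hf => exact A.smul_mem (hf trivial) r

end Monomials

/-! ### Closure of the order under comultiplication and antipode -/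

section Order

variable {p : ℕ} {K : Type*} [Field K]

theorem pow_mem_valRing (ν : AddValuation K (WithTop ℤ)) {π : K} (hπ : ν π = 1) (i : ℕ) :
    π ^ i ∈ valRing ν := by
  refine Subring.pow_mem _ ?_ i
  change 0 ≤ ν π
  rw [hπ]
  exact zero_le_one

theorem ne_zero_of_val (ν : AddValuation K (WithTop ℤ)) {π : K} (hπ : ν π = 1) : π ≠ 0 := by
  rintro rfl
  rw [ν.map_zero] at hπ
  exact absurd hπ (by decide)

theorem val_uniformizer_pow (ν : AddValuation K (WithTop ℤ)) {π : K} (hπ : ν π = 1) (i : ℕ) :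
    ν (π ^ i) = ((i : ℤ) : WithTop ℤ) := by
  rw [ν.map_pow, hπ]
  simp

variable {C : Type*} [CommRing C] [Algebra K C]

theorem congrOne_one_add_smul (ν : AddValuation K (WithTop ℤ)) {π : K} (hπ : ν π = 1)
    [Algebra (valRing ν) C] [IsScalarTower (valRing ν) K C] {D : Subalgebra (valRing ν) C}
    {q : C} (hq : q ∈ D) {c : K} {i k : ℕ}
    (hc : (((k : ℤ) - p * i : ℤ) : WithTop ℤ) ≤ ν c) :
    CongrOne D (π ^ k) (1 + c • (π ^ i) ^ p • q) := by
  have hπ0 := pow_ne_zero k (ne_zero_of_val ν hπ)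
  have hmem : (π ^ k)⁻¹ * (c * (π ^ i) ^ p) ∈ valRing ν := by
    change 0 ≤ ν _
    by_cases hc0 : c = 0
    · simp [hc0]
    obtain ⟨d, hd⟩ := WithTop.ne_top_iff_exists.1 (ν.ne_top_iff.2 hc0)
    have h1 : ν ((π ^ k)⁻¹ * (c * (π ^ i) ^ p)) ≠ ⊤ :=
      ν.ne_top_iff.2 (mul_ne_zero (inv_ne_zero hπ0)
        (mul_ne_zero hc0 (pow_ne_zero _ (pow_ne_zero _ (ne_zero_of_val ν hπ)))))
    obtain ⟨e, he⟩ := WithTop.ne_top_iff_exists.1 h1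
    have h2 : ν (π ^ k) + ν ((π ^ k)⁻¹ * (c * (π ^ i) ^ p)) = ν c + ν (π ^ (i * p)) := by
      rw [← ν.map_mul, ← ν.map_mul, mul_inv_cancel_left₀ hπ0, pow_mul]
    rw [val_uniformizer_pow ν hπ, val_uniformizer_pow ν hπ, ← he, ← hd] at h2
    rw [← hd] at hc
    rw [← he]
    have h3 : (k : ℤ) + e = d + ((i * p : ℕ) : ℤ) := by exact_mod_cast h2
    have h4 := WithTop.coe_le_coe.1 hc
    push_cast at h3
    refine WithTop.coe_le_coe.2 ?_
    linarith
  refine ⟨_, smul_mem_of_mem hmem hq, ?_⟩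
  rw [smul_smul, smul_smul, mul_inv_cancel_left₀ hπ0]

variable {R : Subring K} {B : Type*} [CommRing B] [Algebra K B] [Algebra R B] [IsScalarTower R K B]
  [Algebra R C] [IsScalarTower R K C]

omit [IsScalarTower R K B] in
theorem congrOne_truncExpAlgebra {π : K} (hπ : π ≠ 0) (G₁ G₂ G₃ : B) (i₁ i₂ i₃ : ℕ) (α β μ : K) :
    CongrOne (truncExpAlgebra R p π G₁ G₂ G₃ i₁ i₂ i₃ α β μ) (π ^ i₁) G₁ ∧
    CongrOne (truncExpAlgebra R p π G₁ G₂ G₃ i₁ i₂ i₃ α β μ) (π ^ i₂) (G₂ * truncExp p G₁ μ) ∧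
    CongrOne (truncExpAlgebra R p π G₁ G₂ G₃ i₁ i₂ i₃ α β μ) (π ^ i₃)
      (G₃ * truncExp p G₁ α * truncExp p (G₂ * truncExp p G₁ μ) β) := by
  have h (i : ℕ) (u : B) : u = 1 + π ^ i • ((π ^ i)⁻¹ • (u - 1)) := by
    rw [smul_inv_smul₀ (pow_ne_zero i hπ), add_sub_cancel]
  exact ⟨⟨_, Algebra.subset_adjoin (by simp), h _ _⟩, ⟨_, Algebra.subset_adjoin (by simp), h _ _⟩,
    ⟨_, Algebra.subset_adjoin (by simp), h _ _⟩⟩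

theorem map_mem_of_congrOne {π : K} (hπ : π ≠ 0) {G₁ G₂ G₃ : B} {i₁ i₂ i₃ : ℕ} {α β μ : K}
    {D : Subalgebra R C} (f : B →ₐ[K] C) (h₁ : CongrOne D (π ^ i₁) (f G₁))
    (h₂ : CongrOne D (π ^ i₂) (f (G₂ * truncExp p G₁ μ)))
    (h₃ : CongrOne D (π ^ i₃) (f (G₃ * truncExp p G₁ α * truncExp p (G₂ * truncExp p G₁ μ) β))) :
    ∀ h ∈ truncExpAlgebra R p π G₁ G₂ G₃ i₁ i₂ i₃ α β μ, f h ∈ D := by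
  have key {i : ℕ} {u : B} (h : CongrOne D (π ^ i) (f u)) : f ((π ^ i)⁻¹ • (u - 1)) ∈ D := by
    rw [map_smul, map_sub, map_one]
    exact h.inv_smul_mem (pow_ne_zero i hπ)
  have : truncExpAlgebra R p π G₁ G₂ G₃ i₁ i₂ i₃ α β μ ≤ D.comap (f.restrictScalars R) := by
    refine Algebra.adjoin_le ?_
    rintro _ (rfl | rfl | rfl)
    · exact key h₁
    · exact key h₂
    · exact key h₃
  exact this

variable [hp : Fact p.Prime] [CharP K p] [CharP C p] [CharP B p]

/-- The truncated exponential generators are multiplicative, up to a factor congruent to `1`, under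
a homomorphism which is the product of two homomorphisms on the group generators. -/
theorem congrOne_comul (ν : AddValuation K (WithTop ℤ)) {π : K} (hπ : ν π = 1)
    [Algebra (valRing ν) C] [IsScalarTower (valRing ν) K C] {D : Subalgebra (valRing ν) C}
    {G₁ G₂ G₃ : B} (hG₁ : G₁ ^ p = 1) (hG₂ : G₂ ^ p = 1)
    {i₁ i₂ i₃ : ℕ} {α β μ : K}
    (hμ : (((i₂ : ℤ) - p * i₁ : ℤ) : WithTop ℤ) ≤ ν (wp p μ))
    (hα : (((i₃ : ℤ) - p * i₁ : ℤ) : WithTop ℤ) ≤ ν (wp p α + wp p μ * β))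
    (hβ : (((i₃ : ℤ) - p * i₂ : ℤ) : WithTop ℤ) ≤ ν (wp p β))
    (l r Δ : B →ₐ[K] C) (hΔ₁ : Δ G₁ = l G₁ * r G₁) (hΔ₂ : Δ G₂ = l G₂ * r G₂)
    (hΔ₃ : Δ G₃ = l G₃ * r G₃)
    (hl₁ : CongrOne D (π ^ i₁) (l G₁)) (hr₁ : CongrOne D (π ^ i₁) (r G₁))
    (hl₂ : CongrOne D (π ^ i₂) (l (G₂ * truncExp p G₁ μ)))
    (hr₂ : CongrOne D (π ^ i₂) (r (G₂ * truncExp p G₁ μ)))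
    (hl₃ : CongrOne D (π ^ i₃)
      (l (G₃ * truncExp p G₁ α * truncExp p (G₂ * truncExp p G₁ μ) β)))
    (hr₃ : CongrOne D (π ^ i₃)
      (r (G₃ * truncExp p G₁ α * truncExp p (G₂ * truncExp p G₁ μ) β))) :
    CongrOne D (π ^ i₁) (Δ G₁) ∧ CongrOne D (π ^ i₂) (Δ (G₂ * truncExp p G₁ μ)) ∧
    CongrOne D (π ^ i₃)
      (Δ (G₃ * truncExp p G₁ α * truncExp p (G₂ * truncExp p G₁ μ) β)) := by
  have hR (i : ℕ) := pow_mem_valRing ν hπ i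
  set u := G₂ * truncExp p G₁ μ with hu
  have hup : u ^ p = 1 := by rw [hu, mul_pow, hG₂, truncExp_pow p hG₁, one_mul]
  have hmap (f : B →ₐ[K] C) {z : B} (hz : z ^ p = 1) : f z ^ p = 1 := by
    rw [← map_pow, hz, map_one]
  obtain ⟨q₁, hq₁, hsq₁, h₁⟩ := exists_truncExp_mul_of_congrOne p (hR i₁) (hmap l hG₁)
    (hmap r hG₁) hl₁ hr₁
  obtain ⟨q₂, hq₂, -, h₂⟩ := exists_truncExp_mul_of_congrOne p (hR i₂) (hmap l hup)
    (hmap r hup) hl₂ hr₂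
  set Q := (π ^ i₁) ^ p • q₁ with hQ
  set F : C := 1 + wp p μ • Q with hF
  have hFD : CongrOne D (π ^ i₂) F := congrOne_one_add_smul ν hπ hq₁ hμ
  have hsq : (wp p μ • Q) * (wp p μ • Q) = 0 := by
    rw [smul_mul_smul_comm, hsq₁, smul_zero]
  have hFp : F ^ p = 1 := by
    rw [hF, add_pow_char, one_pow, pow_eq_zero_of_le hp.out.two_le (by rw [pow_two, hsq]),
      add_zero]
  have hlrp : (l u * r u) ^ p = 1 := by rw [mul_pow, hmap l hup, hmap r hup, one_mul]
  -- Since `Δ u = (l u * r u) * F`, raising it to `[β]` takes two splittings: `F` off first, then `l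
  -- u` from `r u`.
  obtain ⟨q₃, hq₃, -, h₃⟩ := exists_truncExp_mul_of_congrOne p (hR i₂) hlrp hFp
    (hl₂.mul (hR i₂) hr₂) hFD
  have hΔu : Δ u = l u * r u * F := by
    simp only [hu, map_mul, map_truncExp, hΔ₁, hΔ₂, h₁ μ, hF]
    ring
  refine ⟨hΔ₁ ▸ hl₁.mul (hR i₁) hr₁, hΔu ▸ (hl₂.mul (hR i₂) hr₂).mul (hR i₂) hFD, ?_⟩
  have hFβ : truncExp p F β = 1 + β • wp p μ • Q := truncExp_of_mul_self p hsq β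
  -- The correction from `g₁^{[α]}` and the factor `F^{[β]}` involve the same square-zero `Q`, so
  -- their coefficients add. Only the sum is assumed to have large valuation.
  have hQα : (1 + wp p α • Q) * (1 + β • wp p μ • Q) = 1 + (wp p α + wp p μ * β) • Q := by
    simp only [Algebra.smul_def, map_add, map_mul]
    linear_combination (algebraMap K C (wp p α) * algebraMap K C β * algebraMap K C (wp p μ)) * hsq₁
  have hΔv : Δ (G₃ * truncExp p G₁ α * truncExp p u β) =
      l (G₃ * truncExp p G₁ α * truncExp p u β) * r (G₃ * truncExp p G₁ α * truncExp p u β) *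
        ((1 + (wp p α + wp p μ * β) • Q) * (1 + wp p β • (π ^ i₂) ^ p • q₂) *
          (1 + wp p β • (π ^ i₂) ^ p • q₃)) := by
    rw [← hQα]
    simp only [map_mul, map_truncExp, hΔ₁, hΔ₃, hΔu, h₁ α, h₂ β, h₃ β, hFβ]
    ring
  rw [hΔv]
  exact (hl₃.mul (hR i₃) hr₃).mul (hR i₃) (((congrOne_one_add_smul ν hπ hq₁ hα).mul (hR i₃)
    (congrOne_one_add_smul ν hπ hq₂ hβ)).mul (hR i₃) (congrOne_one_add_smul ν hπ hq₃ hβ))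

/-- The truncated exponential generators are inverted by a homomorphism inverting the group
generators. -/
theorem antipode_mul_generators {G₁ G₂ G₃ : B} (hG₁ : G₁ ^ p = 1) (hG₂ : G₂ ^ p = 1)
    {α β μ : K} (σ : B →ₐ[K] B) (h₁ : G₁ * σ G₁ = 1) (h₂ : G₂ * σ G₂ = 1) (h₃ : G₃ * σ G₃ = 1) :
    (G₂ * truncExp p G₁ μ) * σ (G₂ * truncExp p G₁ μ) = 1 ∧
    (G₃ * truncExp p G₁ α * truncExp p (G₂ * truncExp p G₁ μ) β) *
      σ (G₃ * truncExp p G₁ α * truncExp p (G₂ * truncExp p G₁ μ) β) = 1 := by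
  set u := G₂ * truncExp p G₁ μ with hu
  have hup : u ^ p = 1 := by rw [hu, mul_pow, hG₂, truncExp_pow p hG₁, one_mul]
  have hinv (a : K) := truncExp_mul_of_mul_eq_one p hG₁ h₁ a
  have hu1 : u * σ u = 1 := by
    rw [hu, map_mul, map_truncExp, mul_mul_mul_comm, h₂, hinv, one_mul]
  refine ⟨hu1, ?_⟩
  rw [map_mul, map_mul, map_truncExp, map_truncExp, mul_mul_mul_comm,
    mul_mul_mul_comm G₃, h₃, hinv, truncExp_mul_of_mul_eq_one p hup hu1, one_mul, one_mul]

/-- A subalgebra containing the truncated exponential generators contains the group generators. -/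
theorem mem_of_generators_mem {G₁ G₂ G₃ : B} (hG₁ : G₁ ^ p = 1) (hG₂ : G₂ ^ p = 1)
    {α β μ : K} (A : Subalgebra K B) (h₁ : G₁ ∈ A) (h₂ : G₂ * truncExp p G₁ μ ∈ A)
    (h₃ : G₃ * truncExp p G₁ α * truncExp p (G₂ * truncExp p G₁ μ) β ∈ A) :
    G₂ ∈ A ∧ G₃ ∈ A := by
  have key {x t : B} (ht : t ^ p = 1) (htA : t ∈ A) (hx : x * t ∈ A) : x ∈ A := by
    have : x = x * t * t ^ (p - 1) := by
      rw [mul_assoc, ← pow_succ', Nat.sub_add_cancel hp.out.one_le, ht, mul_one]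
    rw [this]
    exact A.mul_mem hx (A.pow_mem htA _)
  have hup : (G₂ * truncExp p G₁ μ) ^ p = 1 := by
    rw [mul_pow, hG₂, truncExp_pow p hG₁, one_mul]
  exact ⟨key (truncExp_pow p hG₁ μ) (truncExp_mem p A h₁ μ) h₂,
    key (truncExp_pow p hG₁ α) (truncExp_mem p A h₁ α)
      (key (truncExp_pow p hup β) (truncExp_mem p A h₂ β) h₃)⟩

end Order

/-! ### The monomial basis, and assembly -/

theorem exists_basis_truncExpAlgebra {p : ℕ} [hp : Fact p.Prime] {K : Type*} [Field K] [CharP K p]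
    (R : Subring K) {π : K} (hπ : π ≠ 0) {G : Type*} [CommGroup G] (hG : Nat.card G = p ^ 3)
    (g₁ g₂ g₃ : G) (hg₁ : g₁ ^ p = 1) (hg₂ : g₂ ^ p = 1) (hg₃ : g₃ ^ p = 1)
    (hgen : Subgroup.closure {g₁, g₂, g₃} = ⊤) (i₁ i₂ i₃ : ℕ) (α β μ : K) :
    ∃ (bH : Basis (Fin p × Fin p × Fin p) R (truncExpAlgebra R p π (MonoidAlgebra.of K G g₁)
        (MonoidAlgebra.of K G g₂) (MonoidAlgebra.of K G g₃) i₁ i₂ i₃ α β μ))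
      (b : Basis (Fin p × Fin p × Fin p) K (MonoidAlgebra K G)),
      ∀ i, (bH i : MonoidAlgebra K G) = b i := by
  have : Finite G := Nat.finite_of_card_ne_zero (by rw [hG]; exact pow_ne_zero _ hp.out.ne_zero)
  have : CharP (MonoidAlgebra K G) p := charP_of_injective_algebraMap' K p
  set G₁ := MonoidAlgebra.of K G g₁ with hG₁
  set G₂ := MonoidAlgebra.of K G g₂ with hG₂
  set G₃ := MonoidAlgebra.of K G g₃ with hG₃
  have h₁ : G₁ ^ p = 1 := by rw [hG₁, ← map_pow, hg₁, map_one]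
  have h₂ : G₂ ^ p = 1 := by rw [hG₂, ← map_pow, hg₂, map_one]
  have h₃ : G₃ ^ p = 1 := by rw [hG₃, ← map_pow, hg₃, map_one]
  set u₂ := G₂ * truncExp p G₁ μ with hu₂
  set u₃ := G₃ * truncExp p G₁ α * truncExp p u₂ β with hu₃
  have hu₂p : u₂ ^ p = 1 := by rw [hu₂, mul_pow, h₂, truncExp_pow p h₁, one_mul]
  have hu₃p : u₃ ^ p = 1 := by
    rw [hu₃, mul_pow, mul_pow, h₃, truncExp_pow p h₁, truncExp_pow p hu₂p, one_mul, one_mul]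
  have hnil (i : ℕ) {u : MonoidAlgebra K G} (hu : u ^ p = 1) :
      ((π ^ i)⁻¹ • (u - 1)) ^ p = 0 := by
    rw [smul_pow, sub_pow_char, hu, one_pow, sub_self, smul_zero]
  have htop : Algebra.adjoin K {(π ^ i₁)⁻¹ • (G₁ - 1), (π ^ i₂)⁻¹ • (u₂ - 1),
      (π ^ i₃)⁻¹ • (u₃ - 1)} = ⊤ := by
    set A := Algebra.adjoin K {(π ^ i₁)⁻¹ • (G₁ - 1), (π ^ i₂)⁻¹ • (u₂ - 1),
      (π ^ i₃)⁻¹ • (u₃ - 1)} with hA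
    have hmem {i : ℕ} {u : MonoidAlgebra K G} (hu : (π ^ i)⁻¹ • (u - 1) ∈ A) : u ∈ A := by
      have := A.add_mem (A.smul_mem hu (π ^ i)) A.one_mem
      rwa [smul_inv_smul₀ (pow_ne_zero i hπ), sub_add_cancel] at this
    have hA₁ : G₁ ∈ A := hmem (Algebra.subset_adjoin (by simp) : (π ^ i₁)⁻¹ • (G₁ - 1) ∈ A)
    have hA₂ : u₂ ∈ A := hmem (Algebra.subset_adjoin (by simp) : (π ^ i₂)⁻¹ • (u₂ - 1) ∈ A)
    have hA₃ : u₃ ∈ A := hmem (Algebra.subset_adjoin (by simp) : (π ^ i₃)⁻¹ • (u₃ - 1) ∈ A)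
    obtain ⟨hB₂, hB₃⟩ := mem_of_generators_mem h₁ h₂ A hA₁ hA₂ hA₃
    refine eq_top_of_of_mem hgen A ?_
    rintro _ (rfl | rfl | rfl)
    · exact hA₁
    · exact hB₂
    · exact hB₃
  have hspan := toSubmodule_adjoin_eq_span_monomials (S := K) (hnil i₁ h₁) (hnil i₂ hu₂p)
    (hnil i₃ hu₃p)
  rw [htop, Algebra.top_toSubmodule] at hspan
  have hcard : Fintype.card (Fin p × Fin p × Fin p) = finrank K (MonoidAlgebra K G) := by
    have := Fintype.ofFinite G
    rw [finrank_eq_card_basis (MonoidAlgebra.basis G K), ← Nat.card_eq_fintype_card (α := G), hG]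
    simp
    ring
  -- Spanning by `p³` monomials in dimension `p³` gives independence over `K`; the `R`-span of the
  -- same monomials is the order.
  let b := basisOfTopLeSpanOfCardEqFinrank _ hspan.le hcard
  have hb : Submodule.span R (Set.range b) = Subalgebra.toSubmodule
      (truncExpAlgebra R p π G₁ G₂ G₃ i₁ i₂ i₃ α β μ) := by
    rw [coe_basisOfTopLeSpanOfCardEqFinrank]
    exact (toSubmodule_adjoin_eq_span_monomials (S := R) (hnil i₁ h₁) (hnil i₂ hu₂p)
      (hnil i₃ hu₃p)).symm
  refine ⟨(b.restrictScalars R).map (LinearEquiv.ofEq _ _ hb), b, fun i => ?_⟩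
  rw [Basis.map_apply]
  exact b.restrictScalars_apply R i

/-- The truncated exponential algebra is a Hopf order as soon as the valuations of `℘(μ)`,
`℘(α) + ℘(μ) β` and `℘(β)` are large enough. -/
theorem isHopfOrder_truncExpAlgebra {p : ℕ} [Fact p.Prime] {K : Type*} [Field K] [CharP K p]
    (ν : AddValuation K (WithTop ℤ)) {π : K} (hπ : ν π = 1)
    {G : Type*} [CommGroup G] (hG : Nat.card G = p ^ 3)
    {g₁ g₂ g₃ : G} (hg₁ : g₁ ^ p = 1) (hg₂ : g₂ ^ p = 1) (hg₃ : g₃ ^ p = 1)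
    (hgen : Subgroup.closure {g₁, g₂, g₃} = ⊤) {i₁ i₂ i₃ : ℕ} {μ α β : K}
    (hμ : (((i₂ : ℤ) - p * i₁ : ℤ) : WithTop ℤ) ≤ ν (wp p μ))
    (hα : (((i₃ : ℤ) - p * i₁ : ℤ) : WithTop ℤ) ≤ ν (wp p α + wp p μ * β))
    (hβ : (((i₃ : ℤ) - p * i₂ : ℤ) : WithTop ℤ) ≤ ν (wp p β)) :
    IsHopfOrder (valRing ν) K
      (truncExpAlgebra (valRing ν) p π (MonoidAlgebra.of K G g₁) (MonoidAlgebra.of K G g₂)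
        (MonoidAlgebra.of K G g₃) i₁ i₂ i₃ α β μ) := by
  have hπ0 := ne_zero_of_val ν hπ
  have hR (i : ℕ) := pow_mem_valRing ν hπ i
  have : CharP (MonoidAlgebra K G) p := charP_of_injective_algebraMap' K p
  have : CharP (MonoidAlgebra K G ⊗[K] MonoidAlgebra K G) p := charP_of_injective_algebraMap' K p
  set H := truncExpAlgebra (valRing ν) p π (MonoidAlgebra.of K G g₁) (MonoidAlgebra.of K G g₂)
    (MonoidAlgebra.of K G g₃) i₁ i₂ i₃ α β μ
  obtain ⟨bH, b, hb⟩ : ∃ (bH : Basis (Fin p × Fin p × Fin p) (valRing ν) H)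
      (b : Basis (Fin p × Fin p × Fin p) K (MonoidAlgebra K G)),
      ∀ i, (bH i : MonoidAlgebra K G) = b i :=
    exists_basis_truncExpAlgebra (valRing ν) hπ0 hG g₁ g₂ g₃ hg₁ hg₂ hg₃ hgen i₁ i₂ i₃ α β μ
  have hpow {g : G} (hg : g ^ p = 1) : MonoidAlgebra.of K G g ^ p = 1 := by
    rw [← map_pow, hg, map_one]
  obtain ⟨c₁, c₂, c₃⟩ := congrOne_truncExpAlgebra (R := valRing ν) (p := p) hπ0
    (MonoidAlgebra.of K G g₁) (MonoidAlgebra.of K G g₂) (MonoidAlgebra.of K G g₃) i₁ i₂ i₃ α β μ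
  refine isHopfOrder_of_basis Subtype.val_injective bH b hb ?_ ?_ ?_
  · have hl : ∀ d ∈ H, (Algebra.TensorProduct.includeLeft :
        MonoidAlgebra K G →ₐ[K] MonoidAlgebra K G ⊗[K] MonoidAlgebra K G) d ∈
        (tensorVal K H).range :=
      fun d hd => ⟨(⟨d, hd⟩ : H) ⊗ₜ 1, by simp⟩
    have hr : ∀ d ∈ H, (Algebra.TensorProduct.includeRight :
        MonoidAlgebra K G →ₐ[K] MonoidAlgebra K G ⊗[K] MonoidAlgebra K G) d ∈
        (tensorVal K H).range :=
      fun d hd => ⟨1 ⊗ₜ (⟨d, hd⟩ : H), by simp⟩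
    have hΔ (g : G) : Bialgebra.comulAlgHom K (MonoidAlgebra K G) (MonoidAlgebra.of K G g) =
        (Algebra.TensorProduct.includeLeft :
          MonoidAlgebra K G →ₐ[K] MonoidAlgebra K G ⊗[K] MonoidAlgebra K G)
            (MonoidAlgebra.of K G g) *
        (Algebra.TensorProduct.includeRight :
          MonoidAlgebra K G →ₐ[K] MonoidAlgebra K G ⊗[K] MonoidAlgebra K G)
            (MonoidAlgebra.of K G g) := by
      simp
    obtain ⟨d₁, d₂, d₃⟩ := congrOne_comul ν hπ (hpow hg₁) (hpow hg₂) hμ hα hβ _ _ _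
      (hΔ g₁) (hΔ g₂) (hΔ g₃) (c₁.map _ hl) (c₁.map _ hr) (c₂.map _ hl) (c₂.map _ hr)
      (c₃.map _ hl) (c₃.map _ hr)
    exact map_mem_of_congrOne hπ0 (Bialgebra.comulAlgHom K (MonoidAlgebra K G)) d₁ d₂ d₃
  · have hε (g : G) : Bialgebra.counitAlgHom K (MonoidAlgebra K G) (MonoidAlgebra.of K G g) = 1 := by
      simp
    -- The target `⊥` is `R` inside `K`: the counit sends each of `g₁`, `u₂`, `u₃` to `1`, hence the
    -- algebra generators to `0`.
    have key := map_mem_of_congrOne (R := valRing ν) (p := p) (D := ⊥) (i₁ := i₁) (i₂ := i₂)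
      (i₃ := i₃) (α := α) (β := β) (μ := μ) hπ0 (Bialgebra.counitAlgHom K (MonoidAlgebra K G))
      (G₁ := MonoidAlgebra.of K G g₁) (G₂ := MonoidAlgebra.of K G g₂)
      (G₃ := MonoidAlgebra.of K G g₃)
      (by rw [hε]; exact congrOne_one)
      (by rw [map_mul, map_truncExp, hε, hε, truncExp_one, mul_one]; exact congrOne_one)
      (by
        simp only [map_mul, map_truncExp, hε, truncExp_one, mul_one]
        exact congrOne_one)
    exact fun h hh => Algebra.mem_bot.1 (key h hh)
  · let σ := HopfAlgebra.antipodeAlgHom K (MonoidAlgebra K G)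
    have hσ (g : G) : MonoidAlgebra.of K G g * σ (MonoidAlgebra.of K G g) = 1 := by
      have : σ (MonoidAlgebra.of K G g) = MonoidAlgebra.of K G g⁻¹ := by
        change HopfAlgebra.antipode K _ = _
        simp
      rw [this, ← map_mul, mul_inv_cancel, map_one]
    obtain ⟨s₂, s₃⟩ := antipode_mul_generators (α := α) (β := β) (μ := μ) (hpow hg₁) (hpow hg₂) σ
      (hσ g₁) (hσ g₂) (hσ g₃)
    have hup := mul_pow (MonoidAlgebra.of K G g₂) (truncExp p (MonoidAlgebra.of K G g₁) μ) p
    rw [hpow hg₂, truncExp_pow p (hpow hg₁), one_mul] at hup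
    have hvp : (MonoidAlgebra.of K G g₃ * truncExp p (MonoidAlgebra.of K G g₁) α *
        truncExp p (MonoidAlgebra.of K G g₂ * truncExp p (MonoidAlgebra.of K G g₁) μ) β) ^ p =
        1 := by
      rw [mul_pow, mul_pow, hpow hg₃, truncExp_pow p (hpow hg₁), truncExp_pow p hup, one_mul,
        one_mul]
    have key {i : ℕ} {u : MonoidAlgebra K G} (hu : u ^ p = 1) (hσu : u * σ u = 1)
        (hc : CongrOne H (π ^ i) u) : CongrOne H (π ^ i) (σ u) := by
      -- The inverse is a positive power of `u`, so it inherits the congruence to `1`.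
      have : σ u = u ^ (p - 1) := by
        have h1 : u * u ^ (p - 1) = 1 := by
          rw [← pow_succ', Nat.sub_add_cancel (Fact.out : p.Prime).one_le, hu]
        calc σ u = u * u ^ (p - 1) * σ u := by rw [h1, one_mul]
          _ = u ^ (p - 1) * (u * σ u) := by ring
          _ = u ^ (p - 1) := by rw [hσu, mul_one]
      rw [this]
      exact hc.pow (hR i) _
    exact map_mem_of_congrOne hπ0 σ (key (hpow hg₁) (hσ g₁) c₁) (key hup s₂ c₂) (key hvp s₃ c₃)

end HopfOrders

end

theorem mainTheorem4 {p : ℕ} [Fact p.Prime]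
    {K : Type*} [Field K] [CharP K p]
    (ν : AddValuation K (WithTop ℤ)) (hν : HopfOrders.IsCompleteVal ν)
    (π : K) (hπ : ν π = 1)
    {G : Type*} [CommGroup G] (hG : Nat.card G = p ^ 3)
    (g₁ g₂ g₃ : G) (hg₁ : g₁ ^ p = 1) (hg₂ : g₂ ^ p = 1) (hg₃ : g₃ ^ p = 1)
    (hgen : Subgroup.closure {g₁, g₂, g₃} = ⊤)
    (i₁ i₂ i₃ : ℕ) (μ α β : K)
    (hμ : (((i₂ : ℤ) - p * i₁ : ℤ) : WithTop ℤ) ≤ ν (HopfOrders.wp p μ))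
    (hα : (((i₃ : ℤ) - p * i₁ : ℤ) : WithTop ℤ) ≤
      ν (HopfOrders.wp p α + HopfOrders.wp p μ * β))
    (hβ : (((i₃ : ℤ) - p * i₂ : ℤ) : WithTop ℤ) ≤ ν (HopfOrders.wp p β))
    (hμ' : (((i₃ : ℤ) - i₁ : ℤ) : WithTop ℤ) ≤ ν μ)
    (h23 : i₃ ≤ i₂) :
    HopfOrders.IsHopfOrder (HopfOrders.valRing ν) K
      (HopfOrders.truncExpAlgebra (HopfOrders.valRing ν) p π
        (MonoidAlgebra.of K G g₁) (MonoidAlgebra.of K G g₂) (MonoidAlgebra.of K G g₃)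
        i₁ i₂ i₃ α β μ) :=
  HopfOrders.isHopfOrder_truncExpAlgebra ν hπ hG hg₁ hg₂ hg₃ hgen hμ hα hβ
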